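/- Let $G$ be an infinite discrete group acting continuously on a compact metric space $(X,d)$. Assume that the system $(X,G)$ is minimal (that is, $X\neq\emptyset$ and every orbit $Gx$ is dense in $X$) and admits an invariant measure, i.e. a Borel probability measure $\mu$ on $X$ with $\mu(gA)=\mu(A)$ for all $g\in G$ and all Borel sets $A\subseteq X$. Definitions. A set is residual in $X$ if it contains a dense $G_\delta$ subset of $X$. A pair $(x,y)\in X\times X$ is proximal if $\inf_{g\in G}d(gx,gy)=0$ and distal if $\inf_{g\in G}d(gx,gy)>0$; $P(X,G)\subseteq X\times X$ is the set of all proximal pairs. A point $x$ is distal if $(x,y)$ is a distal pair for every $y\in\overline{Gx}\setminus\{x\}$; the system $(X,G)$ is distal if any two distinct points form a distal pair, and point-distal if the set of distal points is residual in $X$. A set $A\subseteq G$ is an IP-set if there is an infinite sequence $(p_i)_{i\ge1}$ in $G$ such that $A$ contains all products $p_{i_1}p_{i_2}\cdots p_{i_k}$ with $k\ge1$ and $i_1<i_2<\dots<i_k$; a set $F\subseteq G$ is an IP$^*$-set if it meets every IP-set. A point $x\in X$ is pairwise IP$^*$-equicontinuous if for every $\varepsilon>0$ there is a neighbourhood $U$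 of $x$ such that for all $y,z\in U$ the set $\{g\in G: d(gy,gz)<\varepsilon\}$ is an IP$^*$-set; $(X,G)$ is almost pairwise IP$^*$-equicontinuous if the set of such points is residual in $X$. A factor map is a continuous surjection between compact metric $G$-systems that commutes with the actions. A maximal distal factor of $(X,G)$ is a factor map $\pi:(X,G)\to(X_d,G)$ with $(X_d,G)$ distal such that every factor map $\varphi:(X,G)\to(Z,G)$ onto a distal system is of the form $\varphi=\psi\circ\pi$ for some factor map $\psi:(X_d,G)\to(Z,G)$. A factor map $\pi$ defined on $X$ is almost one-to-one if $\{x\in X:\pi^{-1}(\pi(x))=\{x\}\}$ is residual in $X$. Theorem. $(X,G)$ has a maximal distal factor, and for every maximal distal factor $\pi:(X,G)\to(X_d,G)$ (it is unique up to conjugacy) the following statements are equivalent: 1. $(X,G)$ is almost pairwise IP$^*$-equicontinuous; 2. $(X,G)$ is point-distal and $P(X,G)$ is a closed subset of $X\times X$; 3. $\pi:(X,G)\to(X_d,G)$ is almost one-to-one. -/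

import Mathlib

open Topology MeasureTheory

universe u v

namespace TopDyn

section Combinatorics

variable {G : Type v} [Group G]

/-- A set containing all finite products `p i₁ * ⋯ * p iₖ` (`i₁ < ⋯ < iₖ`, `1 ≤ k`) of some
infinite sequence `p` in `G`. -/
def IsIPSet (F : Set G) : Prop :=
  ∃ p : Stream' G, Hindman.FP p ⊆ F

/-- A set which meets every IP-set. -/
def IsIPStarSet (F : Set G) : Prop :=
  ∀ A : Set G, IsIPSet A → (F ∩ A).Nonempty

end Combinatorics

section Systems

variable (G : Type v) [Group G]

section OneSystem

variable {X : Type u} [MetricSpace X] [MulAction G X]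

/-- `(x, y)` is a proximal pair. -/
def IsProximalPair (x y : X) : Prop :=
  ⨅ g : G, dist (g • x) (g • y) = 0

/-- `(x, y)` is a distal pair. -/
def IsDistalPair (x y : X) : Prop :=
  0 < ⨅ g : G, dist (g • x) (g • y)

/-- `x` forms a distal pair with every other point of its orbit closure. -/
def IsDistalPoint (x : X) : Prop :=
  ∀ y ∈ closure (MulAction.orbit G x), y ≠ x → IsDistalPair G x y

/-- For every `ε > 0` there is a neighbourhood `U` of `x` such that any two points of `U` are
`ε`-close along an IP*-set of times. -/
def IsPairwiseIPStarEquicontinuousPoint (x : X) : Prop :=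
  ∀ ε : ℝ, 0 < ε → ∃ U ∈ 𝓝 x, ∀ y ∈ U, ∀ z ∈ U,
    IsIPStarSet {g : G | dist (g • y) (g • z) < ε}

variable (X)

/-- The proximal relation `P(X, G)`. -/
def proximalRelation : Set (X × X) :=
  {p | IsProximalPair G p.1 p.2}

/-- Any two distinct points form a distal pair. -/
def IsDistalSystem : Prop :=
  ∀ x y : X, x ≠ y → IsDistalPair G x y

/-- The distal points form a residual set. -/
def IsPointDistal : Prop :=
  {x : X | IsDistalPoint G x} ∈ residual X

/-- The pairwise IP*-equicontinuous points form a residual set. -/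
def IsAlmostPairwiseIPStarEquicontinuous : Prop :=
  {x : X | IsPairwiseIPStarEquicontinuousPoint G x} ∈ residual X

/-- The system admits an invariant Borel probability measure. -/
def AdmitsInvariantMeasure [MeasurableSpace X] : Prop :=
  ∃ μ : Measure X, IsProbabilityMeasure μ ∧ SMulInvariantMeasure G X μ

end OneSystem

/-- A factor map: a continuous equivariant surjection. -/
structure IsFactorMap {X Y : Type u} [TopologicalSpace X] [TopologicalSpace Y]
    [MulAction G X] [MulAction G Y] (π : X → Y) : Prop where
  continuous : Continuous π
  surjective : Function.Surjective π
  map_smul : ∀ (g : G) (x : X), π (g • x) = g • π x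

/-- `π : X → Y` is the maximal distal factor of `X`: it is a distal factor, and every distal
factor `φ : X → Z` of `X` is a factor of `Y` through `π`. (Every factor of `X` is conjugate to a
quotient of `X`, so nothing is lost by taking `Z` in the universe of `X`.) -/
structure IsMaximalDistalFactor {X Y : Type u} [MetricSpace X] [MetricSpace Y]
    [MulAction G X] [MulAction G Y] (π : X → Y) : Prop where
  isFactorMap : IsFactorMap G π
  distal : IsDistalSystem G Y
  maximal : ∀ (Z : Type u) [MetricSpace Z] [CompactSpace Z] [MulAction G Z]
    [ContinuousConstSMul G Z] (φ : X → Z), IsFactorMap G φ → IsDistalSystem G Z →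
      ∃ ψ : Y → Z, IsFactorMap G ψ ∧ ψ ∘ π = φ

end Systems

/-- The points which are alone in their fibre form a residual set. -/
def IsAlmostOneToOne {X Y : Type u} [TopologicalSpace X] (π : X → Y) : Prop :=
  {x : X | π ⁻¹' {π x} = {x}} ∈ residual X

end TopDyn

open Filter Set

namespace TopDyn

-- The argument lives in `βG`: a set is IP* iff it belongs to every idempotent, and in a minimal
-- system (x, y) is proximal iff some idempotent sends x to y. 1 ⇒ 2: every idempotent fixes an
-- equicontinuity point x. If it sent x to y ≠ x, measure recurrence in a small ball at x would give
-- a point z of the ball returning to it along an IP-set of times g with gx near y, while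
-- IP*-equicontinuity puts gx near gz for one of them. So x is distal; moving limits of proximal
-- pairs close to x shows that P is closed. 2 ⇒ 3: a closed P is an equivalence relation and X/P is
-- distal, so points in one fibre of π are proximal, and a distal point is alone in its fibre. 3 ⇒
-- 1: idempotents act trivially on a distal factor, so points near a singleton fibre are sent back
-- near it.

attribute [local instance] Ultrafilter.mul Ultrafilter.semigroup

/-! ### IP*-sets and idempotent ultrafilters -/

section IPStar

variable {G : Type v} [Group G]

theorem isIPStarSet_iff_mem_idempotent {F : Set G} :
    IsIPStarSet F ↔ ∀ U : Ultrafilter G, U * U = U → F ∈ U := by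
  constructor
  · intro hF U hU
    by_contra hn
    obtain ⟨a, ha⟩ := Hindman.exists_FP_of_large U hU Fᶜ (Ultrafilter.compl_mem_iff_notMem.2 hn)
    obtain ⟨g, hg, hg'⟩ := hF Fᶜ ⟨a, ha⟩
    exact hg' hg
  · rintro hF A ⟨p, hp⟩
    obtain ⟨U, hU, hUp⟩ := Hindman.exists_idempotent_ultrafilter_le_FP p
    exact U.nonempty_of_mem (inter_mem (hF U hU) (mem_of_superset hUp hp))

end IPStar

/-! ### The action of `βG` by limits -/

section Limits

variable {G : Type v} [Group G] {X : Type u} [TopologicalSpace X] [MulAction G X]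

theorem exists_tendsto_smul [CompactSpace X] (U : Ultrafilter G) (x : X) :
    ∃ y, Tendsto (fun g : G => g • x) U (𝓝 y) :=
  ⟨_, (U.map fun g : G => g • x).le_nhds_lim⟩

/-- In `U * V` the factor `V` acts first. -/
theorem tendsto_smul_mul [ContinuousConstSMul G X] {U V : Ultrafilter G} {x y z : X}
    (hV : Tendsto (fun g : G => g • x) V (𝓝 y)) (hU : Tendsto (fun g : G => g • y) U (𝓝 z)) :
    Tendsto (fun g : G => g • x) ((U * V : Ultrafilter G) : Filter G) (𝓝 z) := by
  rw [(nhds_basis_opens z).tendsto_right_iff]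
  rintro s ⟨hz, hs⟩
  rw [Ultrafilter.eventually_mul]
  filter_upwards [hU.eventually (hs.mem_nhds hz)] with g hg
  have h : Tendsto (fun g' : G => g • g' • x) V (𝓝 (g • y)) :=
    ((continuous_const_smul g).tendsto y).comp hV
  filter_upwards [h.eventually (hs.mem_nhds hg)] with g' hg'
  simpa only [mul_smul] using! hg'

theorem tendsto_smul_of_idempotent [CompactSpace X] [T2Space X] [ContinuousConstSMul G X]
    {U : Ultrafilter G} (hU : U * U = U) {x y : X}
    (h : Tendsto (fun g : G => g • x) U (𝓝 y)) : Tendsto (fun g : G => g • y) U (𝓝 y) := by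
  obtain ⟨z, hz⟩ := exists_tendsto_smul U y
  have h' := tendsto_smul_mul h hz
  rw [hU] at h'
  rwa [tendsto_nhds_unique h' h] at hz

theorem isClosed_setOf_tendsto_smul (x y : X) :
    IsClosed {U : Ultrafilter G | Tendsto (fun g : G => g • x) U (𝓝 y)} := by
  have : {U : Ultrafilter G | Tendsto (fun g : G => g • x) U (𝓝 y)} =
      ⋂ s ∈ 𝓝 y, {U : Ultrafilter G | (fun g : G => g • x) ⁻¹' s ∈ U} := by
    ext U
    simp only [mem_ofPred_eq, mem_iInter]
    rfl
  rw [this]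
  exact isClosed_biInter fun s _ => ultrafilter_isClosed_basic _

theorem exists_ultrafilter_tendsto_smul [MulAction.IsMinimal G X] (x y : X) :
    ∃ U : Ultrafilter G, Tendsto (fun g : G => g • x) U (𝓝 y) := by
  have h : (comap (fun g : G => g • x) (𝓝 y)).NeBot := by
    rw [comap_neBot_iff]
    intro t ht
    obtain ⟨g, hg⟩ := isOpen_interior.exists_smul_mem G x ⟨y, mem_interior_iff_mem_nhds.2 ht⟩
    exact ⟨g, interior_subset hg⟩
  exact ⟨Ultrafilter.of _, tendsto_iff_comap.2 (Ultrafilter.of_le _)⟩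

end Limits

/-! ### Proximal pairs through ultrafilters -/

section Proximal

variable {G : Type v} [Group G] {X : Type u} [MetricSpace X] [MulAction G X]

theorem bddBelow_range_dist_smul (x y : X) :
    BddBelow (range fun g : G => dist (g • x) (g • y)) :=
  ⟨0, by rintro _ ⟨g, rfl⟩; exact dist_nonneg⟩

theorem isProximalPair_iff {x y : X} :
    IsProximalPair G x y ↔ ∀ ε > 0, ∃ g : G, dist (g • x) (g • y) < ε := by
  constructor
  · intro h ε hε
    exact exists_lt_of_ciInf_lt (lt_of_eq_of_lt h hε)
  · intro h
    refine le_antisymm (le_of_forall_pos_le_add fun ε hε => ?_)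
      (le_ciInf fun _ => dist_nonneg)
    obtain ⟨g, hg⟩ := h ε hε
    linarith [ciInf_le (bddBelow_range_dist_smul x y) g]

theorem isDistalPair_iff_not_isProximalPair {x y : X} :
    IsDistalPair G x y ↔ ¬ IsProximalPair G x y :=
  ⟨fun h h' => h.ne' h', fun h => lt_of_le_of_ne (le_ciInf fun _ => dist_nonneg) (Ne.symm h)⟩

theorem isDistalSystem_iff : IsDistalSystem G X ↔ ∀ x y : X, IsProximalPair G x y → x = y := by
  simp only [IsDistalSystem, isDistalPair_iff_not_isProximalPair]
  exact ⟨fun h x y hp => by_contra fun hn => h x y hn hp, fun h x y hn hp => hn (h x y hp)⟩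

theorem isProximalPair_iff_exists_tendsto [CompactSpace X] {x y : X} :
    IsProximalPair G x y ↔ ∃ (U : Ultrafilter G) (z : X),
      Tendsto (fun g : G => g • x) U (𝓝 z) ∧ Tendsto (fun g : G => g • y) U (𝓝 z) := by
  rw [isProximalPair_iff]
  constructor
  · intro h
    have hne : (comap (fun g : G => dist (g • x) (g • y)) (𝓝 0)).NeBot := by
      rw [comap_neBot_iff]
      intro t ht
      obtain ⟨ε, hε, ht⟩ := Metric.mem_nhds_iff.1 ht
      obtain ⟨g, hg⟩ := h ε hε
      refine ⟨g, ht ?_⟩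
      simpa [abs_of_nonneg dist_nonneg] using hg
    let U := Ultrafilter.of (comap (fun g : G => dist (g • x) (g • y)) (𝓝 0))
    obtain ⟨z, hz⟩ := exists_tendsto_smul U x
    refine ⟨U, z, hz, ?_⟩
    exact (tendsto_iff_of_dist (tendsto_iff_comap.2 (Ultrafilter.of_le _))).1 hz
  · rintro ⟨U, z, hx, hy⟩ ε hε
    have h := hx.dist hy
    rw [dist_self] at h
    exact (h.eventually (gt_mem_nhds hε)).exists

theorem IsProximalPair.symm {x y : X} (h : IsProximalPair G x y) : IsProximalPair G y x := by
  simpa only [IsProximalPair, dist_comm] using h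

theorem IsProximalPair.smul {x y : X} (h : IsProximalPair G x y) (g : G) :
    IsProximalPair G (g • x) (g • y) := by
  rw [isProximalPair_iff] at h ⊢
  intro ε hε
  obtain ⟨k, hk⟩ := h ε hε
  exact ⟨k * g⁻¹, by simpa [smul_smul] using hk⟩

theorem isProximalPair_refl (x : X) : IsProximalPair G x x :=
  isProximalPair_iff.2 fun ε hε => ⟨1, by simpa using hε⟩

theorem IsProximalPair.map [CompactSpace X] {Y : Type u} [MetricSpace Y] [CompactSpace Y]
    [MulAction G Y] {f : X → Y} (hf : Continuous f) (hG : ∀ (g : G) x, f (g • x) = g • f x)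
    {x y : X} (h : IsProximalPair G x y) : IsProximalPair G (f x) (f y) := by
  rw [isProximalPair_iff_exists_tendsto] at h ⊢
  obtain ⟨U, z, hx, hy⟩ := h
  refine ⟨U, f z, ?_, ?_⟩
  · simpa only [← hG] using! (hf.tendsto z).comp hx
  · simpa only [← hG] using! (hf.tendsto z).comp hy

/-- In a minimal system a pair is proximal only if one of its points is the image of both under an
idempotent of `βG`. -/
theorem IsProximalPair.exists_idempotent [CompactSpace X] [ContinuousConstSMul G X]
    [MulAction.IsMinimal G X] {x y : X} (h : IsProximalPair G x y) :
    ∃ U : Ultrafilter G, U * U = U ∧ Tendsto (fun g : G => g • x) U (𝓝 y) ∧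
      Tendsto (fun g : G => g • y) U (𝓝 y) := by
  obtain ⟨V, z, hx, hy⟩ := isProximalPair_iff_exists_tendsto.1 h
  obtain ⟨W, hW⟩ := exists_ultrafilter_tendsto_smul (G := G) z y
  -- Ellis–Numakura on the closed semigroup of ultrafilters sending both x and y to y; it contains
  -- `W * V`, since `V` merges the pair at z and `W` carries z to y.
  obtain ⟨U, ⟨hUx, hUy⟩, hU⟩ := exists_idempotent_in_compact_subsemigroup
    (M := Ultrafilter G) Ultrafilter.continuous_mul_left
    ({U | Tendsto (fun g : G => g • x) U (𝓝 y)} ∩ {U | Tendsto (fun g : G => g • y) U (𝓝 y)})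
    ⟨W * V, tendsto_smul_mul hx hW, tendsto_smul_mul hy hW⟩
    ((isClosed_setOf_tendsto_smul x y).inter (isClosed_setOf_tendsto_smul y y)).isCompact
    fun A hA B hB => ⟨tendsto_smul_mul hB.1 hA.2, tendsto_smul_mul hB.2 hA.2⟩
  exact ⟨U, hU, hUx, hUy⟩

theorem isProximalPair_of_idempotent [CompactSpace X] [ContinuousConstSMul G X]
    {U : Ultrafilter G} (hU : U * U = U) {x y : X} (h : Tendsto (fun g : G => g • x) U (𝓝 y)) :
    IsProximalPair G x y :=
  isProximalPair_iff_exists_tendsto.2 ⟨U, y, h, tendsto_smul_of_idempotent hU h⟩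

theorem isDistalPoint_iff [MulAction.IsMinimal G X] {x : X} :
    IsDistalPoint G x ↔ ∀ y, IsProximalPair G x y → y = x := by
  simp only [IsDistalPoint, isDistalPair_iff_not_isProximalPair,
    (MulAction.dense_orbit G x).closure_eq, mem_univ, true_imp_iff]
  exact ⟨fun h y hp => by_contra fun hn => h y hn hp, fun h y hn hp => hn (h y hp)⟩

end Proximal

/-! ### Measure recurrence along IP-sets -/

section Recurrence

variable {G : Type v} [Group G] {X : Type u} [MulAction G X] [MeasurableSpace X]
  [MeasurableConstSMul G X]

/-- IP* recurrence of sets of positive measure. -/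
theorem isIPStarSet_measure_inter_pos (μ : Measure X) [IsFiniteMeasure μ]
    [SMulInvariantMeasure G X μ] {A : Set X} (hA : MeasurableSet A) (hμA : μ A ≠ 0) :
    IsIPStarSet {g : G | μ (A ∩ (g • ·) ⁻¹' A) ≠ 0} := by
  rintro B ⟨p, hp⟩
  -- Partial products: for m < n the quotient `(h m)⁻¹ * h n` is a finite product of `p`, while the
  -- translates of `A` by the `h n` cannot be pairwise null-intersecting in finite measure.
  let h : ℕ → G := fun n => (List.ofFn fun i : Fin n => p.get i).prod
  have hFP : ∀ (a : Stream' G) (n : ℕ), (List.ofFn fun i : Fin (n + 1) => a.get i).prod ∈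
      Hindman.FP a := by
    intro a n
    induction n generalizing a with
    | zero => simpa using Hindman.FP.head a
    | succ n ih =>
      rw [List.ofFn_succ, List.prod_cons]
      exact Hindman.FP.cons _ _ (ih a.tail)
  have hstep : ∀ m n : ℕ, m < n → (h m)⁻¹ * h n ∈ Hindman.FP p := by
    intro m n hmn
    obtain ⟨k, rfl⟩ := Nat.exists_eq_add_of_lt hmn
    refine Hindman.FP_drop_subset_FP p m ?_
    have : h (m + k + 1) = h m * (List.ofFn fun i : Fin (k + 1) => (p.drop m).get i).prod := by
      simp only [h]
      rw [← List.prod_append, add_assoc, List.ofFn_add]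
      congr 3
      ext i
      simp [Stream'.get_drop]
    rw [this, inv_mul_cancel_left]
    exact hFP _ _
  have hinv : ∀ n, μ ((fun x : X => (h n)⁻¹ • x) ⁻¹' A) = μ A := fun n =>
    measure_preimage_smul_of_nullMeasurableSet hA.nullMeasurableSet _
  have hmeas : ∀ n, MeasurableSet ((fun x : X => (h n)⁻¹ • x) ⁻¹' A) := fun n =>
    measurable_const_smul _ hA
  by_contra hne
  have hnull : ∀ m n, m < n →
      μ ((fun x : X => (h m)⁻¹ • x) ⁻¹' A ∩ (fun x : X => (h n)⁻¹ • x) ⁻¹' A) = 0 := by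
    intro m n hmn
    by_contra hpos
    refine hne ⟨(h m)⁻¹ * h n, ?_, hp (hstep m n hmn)⟩
    rw [← measure_preimage_smul_of_nullMeasurableSet (μ := μ)
      ((hmeas m).inter (hmeas n)).nullMeasurableSet (h n)] at hpos
    rw [mem_ofPred_eq]
    convert hpos using 2
    ext x
    simp [mul_smul, and_comm]
  have hsum := measure_iUnion₀ (μ := μ) (f := fun n => (fun x : X => (h n)⁻¹ • x) ⁻¹' A)
    (fun m n hmn => by
      rcases lt_or_gt_of_ne hmn with hlt | hlt
      · exact hnull m n hlt
      · exact (AEDisjoint.symm (hnull n m hlt)))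
    fun n => (hmeas n).nullMeasurableSet
  simp only [hinv] at hsum
  rw [ENNReal.tsum_const_eq_top_of_ne_zero hμA] at hsum
  exact measure_ne_top μ _ hsum

end Recurrence

section Recurrence

/-- A closed set of positive measure contains a point which stays in it along an IP-set chosen
inside a prescribed member of an idempotent ultrafilter. -/
theorem exists_FP_subset_smul_mem {G : Type v} [Group G] {X : Type u} [TopologicalSpace X]
    [CompactSpace X] [MulAction G X] [ContinuousConstSMul G X] [MeasurableSpace X] [BorelSpace X]
    (μ : Measure X) [IsFiniteMeasure μ] [SMulInvariantMeasure G X μ] {U : Ultrafilter G}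
    (hU : U * U = U) {F : Set G} (hF : F ∈ U) {A : Set X} (hA : IsClosed A) (hμA : μ A ≠ 0) :
    ∃ a : Stream' G, Hindman.FP a ⊆ F ∧ ∃ y ∈ A, ∀ g ∈ Hindman.FP a, g • y ∈ A := by
  -- Hindman's construction run jointly with recurrence: each stage picks g and shrinks (B, H) to (B
  -- ∩ g⁻¹B, H ∩ g⁻¹H). Compactness then gives a point in all the B's.
  let S := {p : Set X × Set G // IsClosed p.1 ∧ μ p.1 ≠ 0 ∧ p.2 ∈ U}
  have hex : ∀ p : S, ∃ g ∈ p.1.2, {m | g * m ∈ p.1.2} ∈ U ∧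
      μ (p.1.1 ∩ (g • ·) ⁻¹' p.1.1) ≠ 0 := by
    rintro ⟨⟨B, H⟩, hB, hμB, hH⟩
    have h1 : ∀ᶠ g in U, ∀ᶠ m in U, g * m ∈ H := by
      have : H ∈ U * U := by rwa [hU]
      exact this
    have h2 := isIPStarSet_iff_mem_idempotent.1
      (isIPStarSet_measure_inter_pos (G := G) μ hB.measurableSet hμB) U hU
    obtain ⟨g, hg, hg1, hg2⟩ := U.nonempty_of_mem (inter_mem hH (inter_mem h1 h2))
    exact ⟨g, hg, hg1, hg2⟩
  choose elem helem hmul hpos using hex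
  let succ : S → S := fun p =>
    ⟨(p.1.1 ∩ (elem p • ·) ⁻¹' p.1.1, p.1.2 ∩ {m | elem p * m ∈ p.1.2}),
      p.2.1.inter (p.2.1.preimage (continuous_const_smul _)), hpos p, inter_mem p.2.2.2 (hmul p)⟩
  have key : ∀ (a : Stream' G), ∀ m ∈ Hindman.FP a, ∀ p, a = Stream'.corec elem succ p →
      m ∈ p.1.2 ∧ ∀ y, (∀ n, y ∈ (succ^[n] p).1.1) → m • y ∈ p.1.1 := by
    intro a m h
    induction h with
    | head' b =>
      rintro p rfl
      rw [Stream'.corec_eq, Stream'.head_cons]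
      exact ⟨helem p, fun y hy => (hy 1).2⟩
    | tail' b m h ih =>
      rintro p rfl
      obtain ⟨h1, h2⟩ := ih (succ p) (by rw [Stream'.corec_eq, Stream'.tail_cons])
      exact ⟨h1.1, fun y hy => (h2 y fun n => hy (n + 1)).1⟩
    | cons' b m h ih =>
      rintro p rfl
      obtain ⟨h1, h2⟩ := ih (succ p) (by rw [Stream'.corec_eq, Stream'.tail_cons])
      rw [Stream'.corec_eq, Stream'.head_cons]
      refine ⟨h1.2, fun y hy => ?_⟩
      rw [mul_smul]
      exact (h2 y fun n => hy (n + 1)).2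
  let p₀ : S := ⟨(A, F), hA, hμA, hF⟩
  obtain ⟨y, hy⟩ : (⋂ n, (succ^[n] p₀).1.1).Nonempty := by
    refine IsCompact.nonempty_iInter_of_sequence_nonempty_isCompact_isClosed _ (fun n => ?_)
      (fun n => nonempty_of_measure_ne_zero (succ^[n] p₀).2.2.1)
      (succ^[0] p₀).2.1.isCompact fun n => (succ^[n] p₀).2.1
    rw [Function.iterate_succ_apply']
    exact inter_subset_left
  rw [mem_iInter] at hy
  exact ⟨Stream'.corec elem succ p₀, fun m hm => (key _ m hm p₀ rfl).1, y, hy 0,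
    fun m hm => (key _ m hm p₀ rfl).2 y hy⟩

end Recurrence

/-! ### Consequences of IP*-equicontinuity -/

section Equicontinuity

variable {G : Type v} [Group G] {X : Type u} [MetricSpace X] [CompactSpace X] [MulAction G X]
  [ContinuousConstSMul G X] [MulAction.IsMinimal G X]

theorem IsPairwiseIPStarEquicontinuousPoint.eq_of_idempotent [MeasurableSpace X] [BorelSpace X]
    (hμ : AdmitsInvariantMeasure G X) {x : X} (hx : IsPairwiseIPStarEquicontinuousPoint G x)
    {U : Ultrafilter G} (hU : U * U = U) {y : X}
    (hy : Tendsto (fun g : G => g • x) U (𝓝 y)) : y = x := by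
  obtain ⟨μ, hprob, hinv⟩ := hμ
  by_contra hne
  have hd : 0 < dist x y := dist_pos.2 (Ne.symm hne)
  have hε : 0 < dist x y / 4 := by linarith
  obtain ⟨V, hV, hVε⟩ := hx _ hε
  obtain ⟨r, hr, hrV⟩ := Metric.nhds_basis_closedBall.mem_iff.1
    (inter_mem hV (Metric.closedBall_mem_nhds x hε))
  -- By minimality, nonempty open sets have positive measure.
  have hμr : μ (Metric.closedBall x r) ≠ 0 := by
    refine ((measure_isOpen_pos_of_smulInvariant_of_compact_ne_zero G isCompact_univ ?_
      Metric.isOpen_ball ⟨x, Metric.mem_ball_self hr⟩).trans_le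
      (measure_mono Metric.ball_subset_closedBall)).ne'
    simp
  obtain ⟨a, haF, z, hz, haz⟩ := exists_FP_subset_smul_mem μ hU
    (hy (Metric.ball_mem_nhds y hε)) Metric.isClosed_closedBall hμr
  obtain ⟨g, hg, hga⟩ := hVε x (mem_of_mem_nhds hV) z (hrV hz).1 _ ⟨a, Subset.rfl⟩
  have h1 : dist (g • z) x ≤ dist x y / 4 := (hrV (haz g hga)).2
  have h2 : dist (g • x) y < dist x y / 4 := haF hga
  have h3 : dist (g • x) (g • z) < dist x y / 4 := hg
  have h4 := dist_triangle4 x (g • z) (g • x) y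
  rw [dist_comm x (g • z), dist_comm (g • z) (g • x)] at h4
  linarith

theorem IsPairwiseIPStarEquicontinuousPoint.isDistalPoint [MeasurableSpace X] [BorelSpace X]
    (hμ : AdmitsInvariantMeasure G X) {x : X} (hx : IsPairwiseIPStarEquicontinuousPoint G x) :
    IsDistalPoint G x := by
  rw [isDistalPoint_iff]
  intro y hxy
  obtain ⟨U, hU, h, -⟩ := hxy.exists_idempotent
  exact hx.eq_of_idempotent hμ hU h

theorem IsPairwiseIPStarEquicontinuousPoint.isClosed_proximalRelation [MeasurableSpace X]
    [BorelSpace X] (hμ : AdmitsInvariantMeasure G X) {x : X}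
    (hx : IsPairwiseIPStarEquicontinuousPoint G x) :
    IsClosed (proximalRelation G X) := by
  refine isClosed_of_closure_subset ?_
  rintro ⟨y, z⟩ hyz
  refine isProximalPair_iff.2 fun ε hε => ?_
  have hε' : 0 < ε / 8 := by linarith
  obtain ⟨V, hV, hVε⟩ := hx _ hε'
  obtain ⟨r, hr, hrV⟩ := Metric.nhds_basis_ball.mem_iff.1
    (inter_mem hV (Metric.ball_mem_nhds x hε'))
  obtain ⟨g, hg⟩ := Metric.isOpen_ball.exists_smul_mem G y ⟨x, Metric.mem_ball_self hr⟩
  have hW : {p : X × X | g • p.1 ∈ Metric.ball x r ∧ dist (g • p.1) (g • y) < ε / 8 ∧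
      dist (g • p.2) (g • z) < ε / 8} ∈ 𝓝 (y, z) := by
    refine IsOpen.mem_nhds ?_ ⟨hg, by simpa using hε', by simpa using hε'⟩
    refine (Metric.isOpen_ball.preimage (by fun_prop)).inter (.inter ?_ ?_)
    · exact isOpen_lt (f := fun p : X × X => dist (g • p.1) (g • y)) (by fun_prop) (by fun_prop)
    · exact isOpen_lt (f := fun p : X × X => dist (g • p.2) (g • z)) (by fun_prop) (by fun_prop)
  obtain ⟨⟨y', z'⟩, ⟨hy'r, hy', hz'⟩, hp⟩ := mem_closure_iff_nhds.1 hyz _ hW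
  -- `U` sends gy' to gz' and fixes the equicontinuity point, so gz' is as close to that point as
  -- IP*-equicontinuity keeps the images of gy'.
  obtain ⟨U, hU, hUy, -⟩ := (IsProximalPair.smul hp g).exists_idempotent
  obtain ⟨w, hw⟩ := exists_tendsto_smul U x
  obtain rfl := hx.eq_of_idempotent hμ hU hw
  have hclose : dist w (g • z') ≤ ε / 8 := by
    refine le_of_tendsto (hw.dist hUy) ?_
    filter_upwards [isIPStarSet_iff_mem_idempotent.1
      (hVε w (mem_of_mem_nhds hV) _ (hrV hy'r).1) U hU] with k hk
    exact hk.le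
  have h1 : dist (g • y) w < ε / 8 := (hrV hg).2
  have h2 := dist_triangle4 (g • y) w (g • z') (g • z)
  exact ⟨g, by linarith⟩

end Equicontinuity

/-! ### Transitivity of a closed proximal relation -/

section ClosedProximal

variable {G : Type v} [Group G] {X : Type u} [MetricSpace X] [CompactSpace X] [MulAction G X]
  [ContinuousConstSMul G X]

omit [CompactSpace X] [ContinuousConstSMul G X] in
theorem mem_of_tendsto_smul {S : Set (X × X)} (hS : IsClosed S)
    (hG : ∀ (g : G) (x y : X), (x, y) ∈ S → (g • x, g • y) ∈ S) {U : Ultrafilter G}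
    {x y z w : X} (h : (x, y) ∈ S) (hx : Tendsto (fun g : G => g • x) U (𝓝 z))
    (hy : Tendsto (fun g : G => g • y) U (𝓝 w)) : (z, w) ∈ S :=
  hS.mem_of_tendsto (hx.prodMk_nhds hy) (Eventually.of_forall fun g => hG g x y h)

theorem IsProximalPair.trans (hP : IsClosed (proximalRelation G X)) {x y z : X}
    (hxy : IsProximalPair G x y) (hyz : IsProximalPair G y z) : IsProximalPair G x z := by
  -- `U` merges x and y at w; its limit of (y, z) stays proximal because P is closed and invariant,
  -- so a second ultrafilter merges the images of x and z.
  obtain ⟨U, w, hx, hy⟩ := isProximalPair_iff_exists_tendsto.1 hxy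
  obtain ⟨t, hz⟩ := exists_tendsto_smul U z
  have hwt : IsProximalPair G w t :=
    mem_of_tendsto_smul hP (fun g x y (h : IsProximalPair G x y) => h.smul g) hyz hy hz
  obtain ⟨V, s, hw, ht⟩ := isProximalPair_iff_exists_tendsto.1 hwt
  exact isProximalPair_iff_exists_tendsto.2
    ⟨V * U, s, tendsto_smul_mul hx hw, tendsto_smul_mul hz ht⟩

end ClosedProximal

/-! ### Compact metrizable quotients -/

section Quotient

variable {X : Type u} [MetricSpace X] [CompactSpace X]

theorem isClosedMap_quotient_mk (s : Setoid X) (hs : IsClosed {p : X × X | s p.1 p.2}) :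
    IsClosedMap (Quotient.mk s) := by
  intro C hC
  refine (isQuotientMap_quotient_mk' (s := s)).isClosed_preimage.1 ?_
  have : Quotient.mk s ⁻¹' (Quotient.mk s '' C) =
      Prod.snd '' ({p : X × X | s p.1 p.2} ∩ Prod.fst ⁻¹' C) := by
    ext x
    constructor
    · rintro ⟨c, hc, h⟩
      exact ⟨(c, x), ⟨Quotient.exact h, hc⟩, rfl⟩
    · rintro ⟨⟨c, y⟩, ⟨h, hc⟩, rfl⟩
      exact ⟨c, hc, Quotient.sound h⟩
  refine (congrArg IsClosed this).mpr ?_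
  exact ((hs.inter (hC.preimage continuous_fst)).isCompact.image continuous_snd).isClosed

theorem t2Space_quotient_of_isClosed (s : Setoid X) (hs : IsClosed {p : X × X | s p.1 p.2}) :
    T2Space (Quotient s) := by
  have hcl := isClosedMap_quotient_mk s hs
  have hsing : ∀ a : Quotient s, IsClosed ({a} : Set (Quotient s)) := by
    rintro ⟨x⟩
    have := hcl {x} isClosed_singleton
    rwa [image_singleton] at this
  have hfib : ∀ a : Quotient s, IsClosed (Quotient.mk s ⁻¹' {a}) := fun a =>
    (hsing a).preimage continuous_quotient_mk'
  refine ⟨fun a b hab => ?_⟩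
  obtain ⟨V, W, hV, hW, haV, hbW, hVW⟩ := normal_separation (hfib a) (hfib b)
    ((disjoint_singleton.2 hab).preimage _)
  refine ⟨_, _, (hcl _ hV.isClosed_compl).isOpen_compl, (hcl _ hW.isClosed_compl).isOpen_compl,
    ?_, ?_, ?_⟩
  · rintro ⟨x, hx, rfl⟩
    exact hx (haV rfl)
  · rintro ⟨x, hx, rfl⟩
    exact hx (hbW rfl)
  · rw [Set.disjoint_left]
    rintro ⟨x⟩ hxV hxW
    refine Set.disjoint_left.1 hVW (?_ : x ∈ V) ?_
    · exact by_contra fun h => hxV ⟨x, h, rfl⟩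
    · exact by_contra fun h => hxW ⟨x, h, rfl⟩

/-- `X × X` is hereditarily Lindelöf, so countably many real functions separate the points of `Y`
and embed it in a countable power of ℝ. -/
theorem metrizableSpace_of_continuous_surjective {Y : Type u} [TopologicalSpace Y] [T2Space Y]
    {f : X → Y} (hf : Continuous f) (hsurj : Function.Surjective f) :
    TopologicalSpace.MetrizableSpace Y := by
  have : CompactSpace Y := hsurj.compactSpace hf
  obtain ⟨T, hT, hTU⟩ := TopologicalSpace.isOpen_iUnion_countable
    (fun k : C(Y, ℝ) => {p : X × X | k (f p.1) ≠ k (f p.2)})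
    (fun k => isOpen_ne_fun (by fun_prop) (by fun_prop))
  have : Countable T := hT.to_subtype
  let e : Y → T → ℝ := fun y k => k.1 y
  have he : Continuous e := continuous_pi fun k => k.1.continuous
  have hinj : Function.Injective e := by
    intro a b hab
    obtain ⟨x, rfl⟩ := hsurj a
    obtain ⟨y, rfl⟩ := hsurj b
    by_contra hne
    obtain ⟨k, hk0, hk1, -⟩ := exists_continuous_zero_one_of_isClosed
      (isClosed_singleton (x := f x)) (isClosed_singleton (x := f y)) (disjoint_singleton.2 hne)
    have hmem : (x, y) ∈ ⋃ k : C(Y, ℝ), {p : X × X | k (f p.1) ≠ k (f p.2)} := by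
      refine mem_iUnion.2 ⟨k, ?_⟩
      simp [hk0 rfl, hk1 rfl]
    rw [← hTU] at hmem
    obtain ⟨l, hl, hne'⟩ := mem_iUnion₂.1 hmem
    exact hne' (congrFun hab ⟨l, hl⟩)
  exact (he.isClosedEmbedding hinj).isEmbedding.metrizableSpace

end Quotient

/-! ### Distal factors -/

section Factors

variable {G : Type v} [Group G] {X : Type u} [MetricSpace X] [CompactSpace X] [MulAction G X]
  [ContinuousConstSMul G X]

/-- A closed invariant equivalence relation is the kernel of a factor map. -/
theorem exists_isFactorMap_of_isClosed (s : Setoid X) (hs : IsClosed {p : X × X | s p.1 p.2})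
    (hG : ∀ (g : G) (x y : X), s x y → s (g • x) (g • y)) :
    ∃ (Y : Type u) (_ : MetricSpace Y) (_ : CompactSpace Y) (_ : MulAction G Y)
      (_ : ContinuousConstSMul G Y) (π : X → Y), IsFactorMap G π ∧
        ∀ x y, π x = π y ↔ s x y := by
  have := t2Space_quotient_of_isClosed s hs
  have := metrizableSpace_of_continuous_surjective (f := Quotient.mk s) continuous_quotient_mk'
    Quotient.mk_surjective
  let : MetricSpace (Quotient s) := TopologicalSpace.metrizableSpaceMetric _
  let : MulAction G (Quotient s) :=
    { smul := fun g => Quotient.map (g • ·) fun x y h => hG g x y h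
      one_smul := by rintro ⟨x⟩; exact congrArg (Quotient.mk s) (one_smul G x)
      mul_smul := by rintro g h ⟨x⟩; exact congrArg (Quotient.mk s) (mul_smul g h x) }
  refine ⟨Quotient s, inferInstance, inferInstance, inferInstance, ⟨fun g => ?_⟩, Quotient.mk s,
    ⟨continuous_quotient_mk', Quotient.mk_surjective, fun _ _ => rfl⟩, fun x y => Quotient.eq⟩
  exact Continuous.quotient_map' (continuous_const_smul g) fun x y h => hG g x y h

omit [ContinuousConstSMul G X] in
theorem IsFactorMap.exists_comp_eq {Y Z : Type u} [MetricSpace Y] [CompactSpace Y] [MulAction G Y]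
    [MetricSpace Z] [MulAction G Z] {π : X → Y} {φ : X → Z} (hπ : IsFactorMap G π)
    (hφ : IsFactorMap G φ) (h : ∀ x y, π x = π y → φ x = φ y) :
    ∃ ψ : Y → Z, IsFactorMap G ψ ∧ ψ ∘ π = φ := by
  let ψ : Y → Z := fun y => φ (hπ.surjective y).choose
  have hψ : ∀ x, ψ (π x) = φ x := fun x => h _ _ (hπ.surjective (π x)).choose_spec
  have hcomp : ψ ∘ π = φ := funext hψ
  have hq : IsQuotientMap π := hπ.continuous.isClosedMap.isQuotientMap hπ.continuous hπ.surjective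
  refine ⟨ψ, ⟨?_, ?_, ?_⟩, hcomp⟩
  · rw [hq.continuous_iff, hcomp]
    exact hφ.continuous
  · intro z
    obtain ⟨x, rfl⟩ := hφ.surjective z
    exact ⟨π x, hψ x⟩
  · intro g y
    obtain ⟨x, rfl⟩ := hπ.surjective y
    rw [← hπ.map_smul, hψ, hψ, hφ.map_smul]

variable (G X) in
/-- Points are equivalent if no distal factor of `X` separates them. -/
def distalSetoid : Setoid X where
  r x y := ∀ (Z : Type u) [MetricSpace Z] [CompactSpace Z] [MulAction G Z]
    [ContinuousConstSMul G Z] (φ : X → Z), IsFactorMap G φ → IsDistalSystem G Z → φ x = φ y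
  iseqv :=
    { refl := fun _ _ _ _ _ _ _ _ _ => rfl
      symm := fun h Z _ _ _ _ φ hφ hZ => (h Z φ hφ hZ).symm
      trans := fun h h' Z _ _ _ _ φ hφ hZ => (h Z φ hφ hZ).trans (h' Z φ hφ hZ) }

omit [CompactSpace X] [ContinuousConstSMul G X] in
theorem isClosed_distalSetoid : IsClosed {p : X × X | distalSetoid G X p.1 p.2} := by
  rw [← isOpen_compl_iff, isOpen_iff_mem_nhds]
  rintro ⟨x, y⟩ hxy
  change ¬ ∀ Z : Type u, _ at hxy
  push Not at hxy
  obtain ⟨Z, _, _, _, _, φ, hφ, hZ, hne⟩ := hxy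
  have hopen : IsOpen {p : X × X | φ p.1 ≠ φ p.2} :=
    isOpen_ne_fun (hφ.continuous.comp continuous_fst) (hφ.continuous.comp continuous_snd)
  filter_upwards [hopen.mem_nhds hne] with p hp h
  exact hp (h Z φ hφ hZ)

variable (G X) in
-- Quotienting by the common kernel of all distal factors stays metrizable, unlike a product over
-- them. The quotient is distal since proximal pairs in it are identified in every distal factor.
theorem exists_isMaximalDistalFactor :
    ∃ (Y : Type u) (_ : MetricSpace Y) (_ : CompactSpace Y) (_ : MulAction G Y)
      (_ : ContinuousConstSMul G Y) (π : X → Y), IsMaximalDistalFactor G π := by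
  obtain ⟨Y, _, _, _, _, π, hπ, hker⟩ := exists_isFactorMap_of_isClosed (distalSetoid G X)
    isClosed_distalSetoid fun g x y h Z _ _ _ _ φ hφ hZ => by
      rw [hφ.map_smul, hφ.map_smul, h Z φ hφ hZ]
  refine ⟨Y, inferInstance, inferInstance, inferInstance, inferInstance, π, hπ, ?_, ?_⟩
  · rw [isDistalSystem_iff]
    intro a b hab
    obtain ⟨x, rfl⟩ := hπ.surjective a
    obtain ⟨y, rfl⟩ := hπ.surjective b
    rw [hker]
    intro Z _ _ _ _ φ hφ hZ
    obtain ⟨ψ, hψ, rfl⟩ := hπ.exists_comp_eq hφ fun x y h => (hker x y).1 h Z φ hφ hZ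
    exact isDistalSystem_iff.1 hZ _ _ (hab.map hψ.continuous hψ.map_smul)
  · intro Z _ _ _ _ φ hφ hZ
    exact hπ.exists_comp_eq hφ fun x y h => (hker x y).1 h Z φ hφ hZ

variable {Y : Type u} [MetricSpace Y] [MulAction G Y]

omit [ContinuousConstSMul G X] in
theorem IsFactorMap.eq_of_isProximalPair [CompactSpace Y] {π : X → Y} (hπ : IsFactorMap G π)
    (hY : IsDistalSystem G Y) {x y : X} (h : IsProximalPair G x y) : π x = π y :=
  isDistalSystem_iff.1 hY _ _ (h.map hπ.continuous hπ.map_smul)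

theorem IsMaximalDistalFactor.isProximalPair_of_eq {π : X → Y} (hπ : IsMaximalDistalFactor G π)
    (hP : IsClosed (proximalRelation G X)) {x y : X} (h : π x = π y) : IsProximalPair G x y := by
  let s : Setoid X :=
    { r := fun x y => IsProximalPair G x y
      iseqv := ⟨isProximalPair_refl, IsProximalPair.symm, IsProximalPair.trans hP⟩ }
  obtain ⟨Z, _, _, _, _, φ, hφ, hker⟩ := exists_isFactorMap_of_isClosed (G := G) s hP
    fun g x y (h : IsProximalPair G x y) => h.smul g
  -- If `U` merges two classes, its limits of representatives are proximal; a further ultrafilter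
  -- merges those, so the representatives were proximal already.
  have hZ : IsDistalSystem G Z := by
    rw [isDistalSystem_iff]
    intro a b hab
    obtain ⟨x, rfl⟩ := hφ.surjective a
    obtain ⟨y, rfl⟩ := hφ.surjective b
    obtain ⟨U, c, hx, hy⟩ := isProximalPair_iff_exists_tendsto.1 hab
    obtain ⟨x', hx'⟩ := exists_tendsto_smul U x
    obtain ⟨y', hy'⟩ := exists_tendsto_smul U y
    have hφx : φ x' = c := tendsto_nhds_unique ((hφ.continuous.tendsto x').comp hx')
      (by simpa only [Function.comp_def, hφ.map_smul] using hx)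
    have hφy : φ y' = c := tendsto_nhds_unique ((hφ.continuous.tendsto y').comp hy')
      (by simpa only [Function.comp_def, hφ.map_smul] using hy)
    have hp : IsProximalPair G x' y' := (hker x' y').1 (hφx.trans hφy.symm)
    obtain ⟨V, w, hVx, hVy⟩ := isProximalPair_iff_exists_tendsto.1 hp
    exact (hker x y).2 (isProximalPair_iff_exists_tendsto.2
      ⟨V * U, w, tendsto_smul_mul hx' hVx, tendsto_smul_mul hy' hVy⟩)
  obtain ⟨ψ, -, rfl⟩ := hπ.maximal Z φ hφ hZ
  exact (hker x y).1 (congrArg ψ h)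

theorem IsFactorMap.isPairwiseIPStarEquicontinuousPoint [CompactSpace Y] {π : X → Y} (hπ : IsFactorMap G π)
    (hY : IsDistalSystem G Y) {x : X} (hx : π ⁻¹' {π x} = {x}) :
    IsPairwiseIPStarEquicontinuousPoint G x := by
  intro ε hε
  have hε' : 0 < ε / 2 := by linarith
  -- The points whose whole fibre lies in the ball: a tube around the singleton fibre.
  let W : Set Y := (π '' (Metric.ball x (ε / 2))ᶜ)ᶜ
  have hW : IsOpen W :=
    (hπ.continuous.isClosedMap _ Metric.isOpen_ball.isClosed_compl).isOpen_compl
  have hxW : π x ∈ W := by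
    rintro ⟨y, hy, hyx⟩
    have : y ∈ π ⁻¹' {π x} := hyx
    rw [hx] at this
    exact hy (this ▸ Metric.mem_ball_self hε')
  have hball : ∀ y, π y ∈ W → dist y x < ε / 2 := fun y hy =>
    by_contra fun hn => hy ⟨y, hn, rfl⟩
  refine ⟨π ⁻¹' W, (hW.preimage hπ.continuous).mem_nhds hxW, fun y hy z hz => ?_⟩
  rw [isIPStarSet_iff_mem_idempotent]
  intro U hU
  have hlim : ∀ y : X, π y ∈ W → ∀ᶠ g in (U : Filter G), dist (g • y) x < ε / 2 := by
    intro y hy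
    obtain ⟨y', hy'⟩ := exists_tendsto_smul U y
    -- The idempotent moves y only within its fibre, which lies in the ball.
    have hπy := hπ.eq_of_isProximalPair hY (isProximalPair_of_idempotent hU hy')
    exact hy'.eventually (Metric.isOpen_ball.mem_nhds (hball y' (hπy ▸ hy)))
  filter_upwards [hlim y hy, hlim z hz] with g h1 h2
  have := dist_triangle_right (g • y) (g • z) x
  exact lt_of_le_of_lt this (by linarith)

end Factors

end TopDyn

theorem theorem3p15 {G : Type v} [Group G] [Infinite G]
    {X : Type u} [MetricSpace X] [CompactSpace X] [MeasurableSpace X] [BorelSpace X]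
    [MulAction G X] [ContinuousConstSMul G X] [MulAction.IsMinimal G X]
    (hμ : TopDyn.AdmitsInvariantMeasure G X) :
    (∃ (Y : Type u) (_ : MetricSpace Y) (_ : CompactSpace Y) (_ : MulAction G Y)
      (_ : ContinuousConstSMul G Y) (π : X → Y), TopDyn.IsMaximalDistalFactor G π) ∧
    ∀ (Xd : Type u) [MetricSpace Xd] [CompactSpace Xd] [MulAction G Xd]
      [ContinuousConstSMul G Xd] (π : X → Xd), TopDyn.IsMaximalDistalFactor G π →
      List.TFAE [
        TopDyn.IsAlmostPairwiseIPStarEquicontinuous G X,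
        TopDyn.IsPointDistal G X ∧ IsClosed (TopDyn.proximalRelation G X),
        TopDyn.IsAlmostOneToOne π] := by
  refine ⟨TopDyn.exists_isMaximalDistalFactor G X, fun Xd _ _ _ _ π hπ => ?_⟩
  have : Nonempty X := by
    obtain ⟨μ, hprob, -⟩ := hμ
    exact nonempty_of_isProbabilityMeasure μ
  tfae_have 1 → 2 := by
    intro h
    obtain ⟨x, hx⟩ := (dense_of_mem_residual h).nonempty
    exact ⟨Filter.mem_of_superset h fun y hy => hy.isDistalPoint hμ,
      hx.isClosed_proximalRelation hμ⟩
  tfae_have 2 → 3 := by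
    rintro ⟨h, hP⟩
    refine Filter.mem_of_superset h fun x hx => Set.Subset.antisymm (fun y hy => ?_) ?_
    · exact TopDyn.isDistalPoint_iff.1 hx y (hπ.isProximalPair_of_eq hP (Eq.symm hy))
    · rintro _ rfl
      rfl
  tfae_have 3 → 1 := fun h => Filter.mem_of_superset h fun x hx =>
    hπ.isFactorMap.isPairwiseIPStarEquicontinuousPoint hπ.distal hx
  tfae_finish
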